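/- Let $n\ge 1$ be an integer, let $\mathfrak S_n$ be the symmetric group, and for $p\ge 0$ let $c_{n,p}$ be the number of sequences $(\tau_1,\dots,\tau_p)$ of transpositions of $\mathfrak S_n$ such that $\tau_1\cdots\tau_p=(1\,2\ldots n)$. For $\sigma\in\mathfrak S_n$ let $\ell(\sigma)$ be the number of cycles of $\sigma$ (fixed points included) and $|\sigma|=n-\ell(\sigma)$. A path of length $k$ is a sequence $(\sigma_0,\dots,\sigma_k)$ in $\mathfrak S_n$ such that $\sigma_i\sigma_{i+1}^{-1}$ is a transposition for $0\le i<k$; its defect is the number of $i\in\{0,\dots,k-1\}$ with $|\sigma_{i+1}|=|\sigma_i|+1$. Let $S(\sigma,k,d)$ be the number of paths of length $k$ and defect $d$ starting at $\sigma_0=\sigma$. (1) If $n\ge 2$, then $c_{n,p}\neq 0$ if and only if $p=n-1+2d$ for some integer $d\ge 0$. If $n=1$, then $c_{1,p}\ne 0$ if and only if $p=0$. (2) If $n\geq 1$ and $p=n-1+2d$ with $d\ge 0$, then (with $0^0=1$) $$c_{n,p}=S((1\ldots n),n-1+2d,d)=\frac{n^{p}}{n!}\sum_{r=0}^{n-1}(-1)^r\binom{n-1}{r}\left(\frac{n-1}{2}-r\right)^{p}.$$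 (3) For every $n\ge1$, $$\sum_{p\ge 0}c_{n,p}\frac{x^p}{p!}=\frac1{n!}\,e^{\frac{n(n-1)}{2}x}\left(1-e^{-nx}\right)^{n-1},$$ both as an identity of formal power series in $x$ and, the series being absolutely convergent, for every complex number $x$. (4) For every $n\ge1$, $c_{n,n-1}=n^{n-2}$, $\;c_{n,n+1}=\frac1{24}(n^2-1)n^{n+1}$ and $$c_{n,n+3}=\frac1{5760}(5n-7)(n+3)(n+2)(n^2-1)n^{n+3}.$$ -/

import Mathlib

open scoped Nat

namespace TranspositionFactorizations

/-- The cycle `(1 … n)` of the symmetric group on `n` letters, the letters being `0, …, n - 1`: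
it sends `i` to `i + 1` and `n - 1` to `0`. -/
def longCycle (n : ℕ) : Equiv.Perm (Fin n) := finRotate n

/-- The number of ways to write the cycle `(1 … n)` as a product `τ₁ τ₂ ⋯ τ_p` of `p` transpositions,
that is, the number of sequences `(τ₁, …, τ_p)` of transpositions with this product. -/
noncomputable def factorizationCount (n p : ℕ) : ℕ :=
  Nat.card {τ : Fin p → Equiv.Perm (Fin n) //
    (∀ i, (τ i).IsSwap) ∧ (List.ofFn τ).prod = longCycle n}

/-- The Cayley graph of the symmetric group generated by all transpositions: `σ₁` and `σ₂` are joined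
by an edge when `σ₁ σ₂⁻¹` is a transposition. -/
def cayleyGraph (n : ℕ) : SimpleGraph (Equiv.Perm (Fin n)) where
  Adj σ₁ σ₂ := (σ₁ * σ₂⁻¹).IsSwap
  symm := ⟨by
    rintro σ₁ σ₂ ⟨x, y, hxy, h⟩
    refine ⟨x, y, hxy, ?_⟩
    have h2 := congrArg (fun f => f⁻¹) h
    simpa using h2⟩
  loopless := ⟨by
    rintro σ ⟨x, y, hxy, h⟩
    rw [mul_inv_cancel] at h
    exact hxy (by simpa using (Equiv.swap_eq_one_iff.mp h.symm))⟩

/-- `ℓ(σ)`, the number of cycles of `σ`, fixed points included. -/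
def cycleCount {n : ℕ} (σ : Equiv.Perm (Fin n)) : ℕ := Multiset.card σ.partition.parts

/-- `|σ| = n - ℓ(σ)`; the subtraction does not truncate, since `ℓ(σ) ≤ n`. -/
def absLength {n : ℕ} (σ : Equiv.Perm (Fin n)) : ℕ := n - cycleCount σ

/-- The sequence `(γ₀, …, γ_k)` of permutations is a path of the Cayley graph. -/
def IsPath {n k : ℕ} (γ : Fin (k + 1) → Equiv.Perm (Fin n)) : Prop :=
  ∀ i : Fin k, (cayleyGraph n).Adj (γ i.castSucc) (γ i.succ)

/-- The defect of a path: the number of its steps which increase the distance to the identity. -/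
def defect {n k : ℕ} (γ : Fin (k + 1) → Equiv.Perm (Fin n)) : ℕ :=
  Finset.card {i : Fin k | absLength (γ i.succ) = absLength (γ i.castSucc) + 1}

/-- `S(σ, k, d)`: the number of paths of length `k` and defect `d` in the Cayley graph that
start at `σ`. -/
noncomputable def pathCount {n : ℕ} (σ : Equiv.Perm (Fin n)) (k d : ℕ) : ℕ :=
  Nat.card {γ : Fin (k + 1) → Equiv.Perm (Fin n) // γ 0 = σ ∧ IsPath γ ∧ defect γ = d}

end TranspositionFactorizations

namespace TranspositionFactorizations

open Polynomial Matrix Finset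

/-! Let M be the permutation matrix of g and R_g = det(1 - XM) / (1 - X). This polynomial detects
long cycles: R_g(1) is n if g has a single orbit and 0 otherwise (`reducedDet_eval_one`).

Left multiplication of g by a transposition changes 1 - XM by a matrix of rank one. By the matrix
determinant lemma, the sum of det(1 - XM) over all τg involves only the trace of adj(1 - XM) M,
which is minus the derivative of the determinant (Jacobi), and the sum of the entries of that
matrix, known because the all-ones vector is fixed by M. The outcome is ∑_τ R_{τg} = D R_g with D =
n(n-1)/2 - n X d/dX (`sum_swaps_reducedDet`). No character theory is needed: D is diagonal on
monomials, with eigenvalue n((n-1)/2 - r) on X^r.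

Iterating p times from R_1 = (1 - X)^(n-1) and evaluating at 1 counts the sequences of p
transpositions whose product is any n-cycle, with weight n. The (n-1)! such cycles are conjugate and
contribute equally, so n! c_{n,p} = (D^p (1 - X)^(n-1))(1). The binomial theorem gives the closed
formula, hence both generating functions; expanding sinh gives the small cases.

Paths correspond to factorizations through partial products. Each step changes |σ| by exactly one,
so the defect determines the endpoint's distance to the identity. -/

/-! ### Determinant identities -/

/-- The matrix determinant lemma, stated with the adjugate. -/
theorem det_add_vecMulVec {R ι : Type*} [CommRing R] [IsDomain R] [Fintype ι] [DecidableEq ι]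
    (B : Matrix ι ι R) (hB : B.det ≠ 0) (u v : ι → R) :
    (B + vecMulVec u v).det = B.det + v ⬝ᵥ (B.adjugate *ᵥ u) := by
  -- In the fraction field a nonzero determinant is a unit, so the version with an inverse applies
  -- there.
  have hinj := IsFractionRing.injective R (FractionRing R)
  apply hinj
  set f := algebraMap R (FractionRing R)
  have hu : IsUnit (f.mapMatrix B).det := by
    rw [← RingHom.map_det]
    exact isUnit_iff_ne_zero.mpr (by simpa using hinj.ne hB)
  have key := det_add_replicateCol_mul_replicateRow (ι := Unit) hu (f ∘ u) (f ∘ v)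
  have h1 : (f.mapMatrix (B + vecMulVec u v)) =
      f.mapMatrix B + replicateCol Unit (f ∘ u) * replicateRow Unit (f ∘ v) := by
    ext i j
    simp [Matrix.mul_apply, vecMulVec_apply]
  rw [RingHom.map_det, h1, key, map_add, RingHom.map_det]
  have h2 : (f.mapMatrix B)⁻¹ = (f.mapMatrix B).det⁻¹ • (f.mapMatrix B).adjugate := by
    rw [Matrix.inv_def, Ring.inverse_eq_inv']
  have h3 : (1 + replicateRow Unit (f ∘ v) * (f.mapMatrix B)⁻¹ * replicateCol Unit (f ∘ u)).det
      = 1 + (f.mapMatrix B).det⁻¹ * ((f ∘ v) ⬝ᵥ ((f.mapMatrix B).adjugate *ᵥ (f ∘ u))) := by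
    rw [det_unique, h2, Matrix.add_apply, Matrix.one_apply_eq, Matrix.mul_assoc, Matrix.smul_mul,
      Matrix.mul_smul, Matrix.smul_apply, smul_eq_mul]
    rfl
  have h4 : f (v ⬝ᵥ (B.adjugate *ᵥ u)) =
      (f ∘ v) ⬝ᵥ ((f.mapMatrix B).adjugate *ᵥ (f ∘ u)) := by
    rw [← RingHom.map_adjugate]
    simp [dotProduct, mulVec, map_sum]
  rw [h3, h4, mul_add, mul_one, mul_inv_cancel_left₀ hu.ne_zero]

/-- Jacobi's formula for the derivative of a determinant of polynomials. -/
theorem derivative_det {R ι : Type*} [CommRing R] [Fintype ι] [DecidableEq ι]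
    (B : Matrix ι ι R[X]) :
    derivative B.det = ∑ i, ∑ j, derivative (B i j) * B.adjugate j i := by
  have h : ∀ j, ∑ i, derivative (B i j) * B.adjugate j i =
      (B.updateCol j fun i => derivative (B i j)).det := by
    intro j
    rw [det_eq_sum_mul_adjugate_col _ j]
    refine sum_congr rfl fun i _ => ?_
    have hadj : ∀ A : Matrix ι ι R[X], A.adjugate j i = (A.updateCol j (Pi.single i 1)).det := by
      intro A
      rw [← cramer_apply, cramer_eq_adjugate_mulVec, mulVec_single_one, col_apply]
    rw [updateCol_self, hadj, hadj, updateCol_idem]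
  rw [sum_comm]
  simp_rw [h, det_apply, derivative_sum]
  rw [sum_comm]
  refine sum_congr rfl fun σ _ => ?_
  rw [← smul_sum, derivative_smul, derivative_prod_finset]
  congr 1
  refine sum_congr rfl fun j _ => ?_
  rw [← mul_prod_erase univ _ (mem_univ j), mul_comm, updateCol_self]
  congr 1
  refine prod_congr rfl fun i hi => ?_
  rw [updateCol_ne (ne_of_mem_erase hi)]

/-! ### The pencil of a permutation and its transposition sum -/

/-- The matrix `1 - X M`, where `M` is the permutation matrix of `g`. -/
noncomputable def permPencil {n : ℕ} (g : Equiv.Perm (Fin n)) : Matrix (Fin n) (Fin n) ℚ[X] :=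
  1 - (X : ℚ[X]) • g.permMatrix ℚ[X]

theorem permPencil_apply {n : ℕ} (g : Equiv.Perm (Fin n)) (i j : Fin n) :
    permPencil g i j = (if i = j then 1 else 0) - X * (if g i = j then 1 else 0) := by
  simp [permPencil, Matrix.one_apply, PEquiv.toMatrix_apply, Equiv.toPEquiv_apply, eq_comm]

theorem eval_det_permPencil {n : ℕ} (g : Equiv.Perm (Fin n)) (t : ℚ) :
    (permPencil g).det.eval t = (1 - t • g.permMatrix ℚ).det := by
  rw [← coe_evalRingHom, RingHom.map_det]
  congr 1
  ext i j
  simp only [permPencil_apply, Matrix.one_apply, PEquiv.toMatrix_apply, Equiv.toPEquiv_apply,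
    RingHom.mapMatrix_apply, Matrix.map_apply, coe_evalRingHom, Matrix.sub_apply, Matrix.smul_apply]
  split_ifs <;> simp_all

theorem det_permPencil_ne_zero {n : ℕ} (g : Equiv.Perm (Fin n)) : (permPencil g).det ≠ 0 := by
  intro h
  have := eval_det_permPencil g 0
  simp [h] at this

theorem permPencil_mulVec {n : ℕ} (g : Equiv.Perm (Fin n)) (v : Fin n → ℚ[X])
    (hv : ∀ i, v (g i) = v i) : permPencil g *ᵥ v = (1 - X : ℚ[X]) • v := by
  rw [permPencil, sub_mulVec, one_mulVec, smul_mulVec, permMatrix_mulVec]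
  ext1 i
  simp [hv, sub_mul]

/-- Only the rows i with g i = a or g i = b change, by opposite multiples of e_a - e_b: a
perturbation of rank one. -/
theorem permPencil_swap_mul {n : ℕ} (g : Equiv.Perm (Fin n)) {a b : Fin n} (hab : a ≠ b) :
    permPencil (Equiv.swap a b * g) = permPencil g +
      vecMulVec ((X : ℚ[X]) • (g.permMatrix ℚ[X] *ᵥ (Pi.single a 1 - Pi.single b 1)))
        (Pi.single a 1 - Pi.single b 1) := by
  ext1 i j
  rw [permMatrix_mulVec, Matrix.add_apply, permPencil_apply, permPencil_apply, vecMulVec_apply]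
  simp only [Equiv.Perm.mul_apply, Pi.smul_apply, Function.comp, Pi.sub_apply, Pi.single_apply,
    smul_eq_mul]
  by_cases h1 : g i = a <;> by_cases h2 : g i = b <;> by_cases h3 : j = a <;>
    by_cases h4 : j = b <;> grind

/-- The set of transpositions. -/
noncomputable def swaps (n : ℕ) : Finset (Equiv.Perm (Fin n)) :=
  (Set.toFinite {τ : Equiv.Perm (Fin n) | τ.IsSwap}).toFinset

theorem mem_swaps {n : ℕ} {τ : Equiv.Perm (Fin n)} : τ ∈ swaps n ↔ τ.IsSwap := by
  simp [swaps]

theorem card_filter_swap_eq {n : ℕ} {τ : Equiv.Perm (Fin n)} (hτ : τ.IsSwap) :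
    #{p : Fin n × Fin n | p.1 ≠ p.2 ∧ Equiv.swap p.1 p.2 = τ} = 2 := by
  obtain ⟨a, b, hab, rfl⟩ := hτ
  have : ({p : Fin n × Fin n | p.1 ≠ p.2 ∧ Equiv.swap p.1 p.2 = Equiv.swap a b} : Finset _) =
      {(a, b), (b, a)} := by
    ext ⟨c, d⟩
    simp only [mem_filter, mem_univ, true_and, mem_insert, mem_singleton, Prod.mk.injEq]
    constructor
    · rintro ⟨hcd, h⟩
      have h1 := congrArg Equiv.Perm.support h
      rw [Equiv.Perm.support_swap hcd, Equiv.Perm.support_swap hab] at h1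
      have hc : c ∈ ({a, b} : Finset (Fin n)) := h1 ▸ by simp
      have hd : d ∈ ({a, b} : Finset (Fin n)) := h1 ▸ by simp
      simp only [mem_insert, mem_singleton] at hc hd
      grind
    · rintro (⟨rfl, rfl⟩ | ⟨rfl, rfl⟩)
      · exact ⟨hab, rfl⟩
      · exact ⟨hab.symm, Equiv.swap_comm _ _⟩
  rw [this, card_pair]
  simpa using fun h => absurd h hab

theorem two_mul_sum_swaps {n : ℕ} {R : Type*} [CommRing R] (f : Equiv.Perm (Fin n) → R) :
    2 * ∑ τ ∈ swaps n, f τ =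
      ∑ p : Fin n × Fin n with p.1 ≠ p.2, f (Equiv.swap p.1 p.2) := by
  rw [← sum_fiberwise_of_maps_to (t := swaps n) (g := fun p : Fin n × Fin n => Equiv.swap p.1 p.2),
    mul_sum]
  · refine sum_congr rfl fun τ hτ => ?_
    rw [filter_filter, sum_congr rfl (g := fun _ => f τ), sum_const,
      card_filter_swap_eq (mem_swaps.mp hτ), nsmul_eq_mul, Nat.cast_ofNat]
    intro p hp
    rw [(mem_filter.mp hp).2.2]
  · rintro ⟨a, b⟩ hp
    exact mem_swaps.mpr ⟨a, b, (mem_filter.mp hp).2, rfl⟩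

theorem two_mul_sum_swaps_det {n : ℕ} (g : Equiv.Perm (Fin n)) :
    2 * ∑ τ ∈ swaps n, (permPencil (τ * g)).det =
      ((n : ℚ[X]) * ((n : ℚ[X]) - 1)) * (permPencil g).det +
      2 * X * ((n : ℚ[X]) * ((permPencil g).adjugate * g.permMatrix ℚ[X]).trace -
        ∑ a, ∑ b, ((permPencil g).adjugate * g.permMatrix ℚ[X]) a b) := by
  set W := (permPencil g).adjugate * g.permMatrix ℚ[X] with hW
  have h1 : ∀ a b : Fin n, a ≠ b → (permPencil (Equiv.swap a b * g)).det =
      (permPencil g).det + X * (W a a + W b b - W a b - W b a) := by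
    intro a b hab
    rw [permPencil_swap_mul g hab, det_add_vecMulVec _ (det_permPencil_ne_zero g), mulVec_smul,
      mulVec_mulVec, ← hW]
    simp only [mulVec_sub, dotProduct_smul, sub_dotProduct, dotProduct_sub,
      single_dotProduct, mulVec_single, one_mul, smul_eq_mul]
    simp
    ring
  rw [two_mul_sum_swaps]
  rw [sum_congr rfl (g := fun p : Fin n × Fin n => (permPencil g).det +
    X * (W p.1 p.1 + W p.2 p.2 - W p.1 p.2 - W p.2 p.1))]
  swap
  · intro p hp
    exact h1 _ _ (mem_filter.mp hp).2
  rw [sum_add_distrib, sum_const, ← mul_sum]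
  have hc : #{p : Fin n × Fin n | p.1 ≠ p.2} = n * n - n := by
    have := offDiag_card (univ : Finset (Fin n))
    rw [card_univ, Fintype.card_fin] at this
    rw [← this]
    congr 1
    ext p
    simp
  -- The summand vanishes on the diagonal, so the restriction to distinct pairs can be dropped.
  have hs : ∑ p : Fin n × Fin n with p.1 ≠ p.2, (W p.1 p.1 + W p.2 p.2 - W p.1 p.2 - W p.2 p.1)
      = ∑ p : Fin n × Fin n, (W p.1 p.1 + W p.2 p.2 - W p.1 p.2 - W p.2 p.1) := by
    rw [sum_filter]
    refine sum_congr rfl fun p _ => ?_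
    split_ifs with h
    · rfl
    · rw [not_not] at h
      rw [h]
      ring
  rw [hs, hc, nsmul_eq_mul, Nat.cast_sub (Nat.le_mul_self n), Fintype.sum_prod_type]
  simp only [sum_sub_distrib, sum_add_distrib, sum_const, card_univ, Fintype.card_fin,
    nsmul_eq_mul, ← mul_sum]
  rw [sum_comm (f := fun x i => W i x), trace]
  simp only [diag_apply]
  push_cast
  ring


theorem adjugate_permPencil_mulVec {n : ℕ} (g : Equiv.Perm (Fin n)) (v : Fin n → ℚ[X])
    (hv : ∀ i, v (g i) = v i) :
    (1 - X : ℚ[X]) • ((permPencil g).adjugate *ᵥ v) = (permPencil g).det • v := by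
  rw [← mulVec_smul, ← permPencil_mulVec g v hv, mulVec_mulVec, adjugate_mul, smul_mulVec,
    one_mulVec]

/-! ### The reduced determinant and the operator acting on it -/

/-- The quotient of `det (1 - X M)` by `1 - X`, where `M` is the permutation matrix of `g`. -/
noncomputable def reducedDet {n : ℕ} (g : Equiv.Perm (Fin n)) : ℚ[X] :=
  -((permPencil g).det /ₘ (X - C 1))

theorem one_sub_X_ne_zero : (1 - X : ℚ[X]) ≠ 0 := by
  intro h
  simpa using congrArg (Polynomial.eval 0) h

theorem one_sub_X_mul_reducedDet {n : ℕ} (hn : 1 ≤ n) (g : Equiv.Perm (Fin n)) :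
    (1 - X) * reducedDet g = (permPencil g).det := by
  have h : (permPencil g).det.IsRoot 1 := by
    have h1 := congrFun (adjugate_permPencil_mulVec g 1 fun _ => rfl) ⟨0, hn⟩
    have h2 := congrArg (Polynomial.eval 1) h1
    simpa using h2.symm
  rw [reducedDet, ← neg_sub, neg_mul_neg, ← C_1, mul_divByMonic_eq_iff_isRoot]
  exact h

theorem adjugate_permPencil_mulVec_eq {n : ℕ} (hn : 1 ≤ n) (g : Equiv.Perm (Fin n))
    (v : Fin n → ℚ[X]) (hv : ∀ i, v (g i) = v i) :
    (permPencil g).adjugate *ᵥ v = reducedDet g • v := by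
  have h := adjugate_permPencil_mulVec g v hv
  rw [← one_sub_X_mul_reducedDet hn, mul_smul] at h
  exact smul_right_injective _ one_sub_X_ne_zero h

theorem trace_adjugate_mul_permMatrix {n : ℕ} (g : Equiv.Perm (Fin n)) :
    ((permPencil g).adjugate * g.permMatrix ℚ[X]).trace = -derivative (permPencil g).det := by
  rw [derivative_det, trace_mul_comm, trace, ← sum_neg_distrib]
  refine sum_congr rfl fun i _ => ?_
  rw [diag_apply, Matrix.mul_apply, ← sum_neg_distrib]
  refine sum_congr rfl fun j _ => ?_
  have hd : derivative (if i = j then (1 : ℚ[X]) else 0) = 0 := by split_ifs <;> simp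
  simp only [permPencil_apply, PEquiv.toMatrix_apply, Equiv.toPEquiv_apply, derivative_sub, hd]
  split_ifs <;> simp_all

theorem sum_adjugate_mul_permMatrix {n : ℕ} (hn : 1 ≤ n) (g : Equiv.Perm (Fin n)) :
    ∑ a, ∑ b, ((permPencil g).adjugate * g.permMatrix ℚ[X]) a b = n * reducedDet g := by
  have h : ((permPencil g).adjugate * g.permMatrix ℚ[X]) *ᵥ 1 = reducedDet g • 1 := by
    rw [← mulVec_mulVec, permMatrix_mulVec, ← adjugate_permPencil_mulVec_eq hn g 1 fun _ => rfl]
    rfl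
  have h2 : ∀ a, ∑ b, ((permPencil g).adjugate * g.permMatrix ℚ[X]) a b = reducedDet g := by
    intro a
    simpa [mulVec, dotProduct] using congrFun h a
  simp [h2]

/-- The operator `n (n - 1) / 2 - n X d/dX` on polynomials. -/
noncomputable def contentOp (n : ℕ) : Module.End ℚ ℚ[X] :=
  ((n : ℚ) * ((n : ℚ) - 1) / 2) • 1 - (n : ℚ) • (LinearMap.mulLeft ℚ X ∘ₗ derivative)

theorem contentOp_apply (n : ℕ) (f : ℚ[X]) :
    contentOp n f = C ((n : ℚ) * ((n : ℚ) - 1) / 2) * f - (n : ℚ[X]) * (X * derivative f) := by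
  simp [contentOp, smul_eq_C_mul]

theorem contentOp_X_pow (n r : ℕ) :
    contentOp n (X ^ r) = ((n : ℚ) * (((n : ℚ) - 1) / 2 - r)) • X ^ r := by
  rw [contentOp_apply, smul_eq_C_mul, derivative_X_pow]
  have : (X : ℚ[X]) * (C (r : ℚ) * X ^ (r - 1)) = C (r : ℚ) * X ^ r := by
    rcases r with _ | r
    · simp
    · rw [Nat.add_sub_cancel, pow_succ]; ring
  rw [this, ← C_eq_natCast n, ← mul_assoc, ← C_mul, ← sub_mul, ← C_sub]
  congr 2
  ring

theorem contentOp_pow_X_pow (n r p : ℕ) :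
    (contentOp n ^ p) (X ^ r) = ((n : ℚ) * (((n : ℚ) - 1) / 2 - r)) ^ p • X ^ r := by
  induction p with
  | zero => simp
  | succ p ih =>
    rw [pow_succ, Module.End.mul_apply, contentOp_X_pow, map_smul, ih, smul_smul, pow_succ,
      mul_comm]

/-- Differentiating (1 - X) R_g gives an extra term -R_g, which cancels exactly against the sum of
the entries of adj(1 - XM) M; what remains is divisible by 1 - X. -/
theorem sum_swaps_reducedDet {n : ℕ} (hn : 1 ≤ n) (g : Equiv.Perm (Fin n)) :
    ∑ τ ∈ swaps n, reducedDet (τ * g) = contentOp n (reducedDet g) := by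
  have h := two_mul_sum_swaps_det g
  simp_rw [← one_sub_X_mul_reducedDet hn] at h
  rw [← mul_sum, trace_adjugate_mul_permMatrix, sum_adjugate_mul_permMatrix hn,
    ← one_sub_X_mul_reducedDet hn, derivative_mul] at h
  apply mul_left_cancel₀ one_sub_X_ne_zero
  apply mul_left_cancel₀ (two_ne_zero (α := ℚ[X]))
  rw [h, contentOp_apply]
  have hC : (2 : ℚ[X]) * C ((n : ℚ) * ((n : ℚ) - 1) / 2) = n * (n - 1) := by
    rw [← C_eq_natCast, ← C_1, ← C_sub, ← C_mul, ← C_ofNat, ← C_mul]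
    congr 1
    ring
  simp only [derivative_sub, derivative_one, derivative_X]
  linear_combination -((1 - X) * reducedDet g) * hC

theorem reducedDet_one {n : ℕ} (hn : 1 ≤ n) :
    reducedDet (1 : Equiv.Perm (Fin n)) = (1 - X) ^ (n - 1) := by
  apply mul_left_cancel₀ one_sub_X_ne_zero
  rw [one_sub_X_mul_reducedDet hn, ← pow_succ', Nat.sub_add_cancel hn]
  have : permPencil (1 : Equiv.Perm (Fin n)) = (1 - X : ℚ[X]) • 1 := by
    rw [permPencil, permMatrix_one, sub_smul, one_smul]
  rw [this, det_smul, det_one, mul_one, Fintype.card_fin]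

/-! ### Value at one: detecting long cycles -/

/-- A permutation with only one orbit. -/
def IsTransitive {n : ℕ} (g : Equiv.Perm (Fin n)) : Prop := ∀ x y, g.SameCycle x y

/-- With at least two orbits, 1 - M has a kernel of dimension at least two, so its adjugate
vanishes; R_g(1) is a row sum of that adjugate. -/
theorem reducedDet_eval_one_of_not_isTransitive {n : ℕ} (hn : 1 ≤ n) (g : Equiv.Perm (Fin n))
    (hg : ¬ IsTransitive g) : (reducedDet g).eval 1 = 0 := by
  classical
  simp only [IsTransitive, not_forall] at hg
  obtain ⟨x, y, hxy⟩ := hg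
  have hadj : ∀ i j, (1 - g.permMatrix ℚ).adjugate i j = 0 := by
    intro i j
    rw [adjugate_apply, ← exists_mulVec_eq_zero_iff]
    set b : Prop := g.SameCycle x i with hb
    -- Of the cycle of x and its complement, take the indicator of the one not containing i: it is
    -- g-invariant, and it is killed by the replaced row e_i.
    refine ⟨fun k => if (g.SameCycle x k ↔ b) then 0 else 1, ?_, ?_⟩
    · intro h
      by_cases hxi : g.SameCycle x i
      · simpa [hb, hxi, hxy] using congrFun h y
      · simpa [hb, hxi, Equiv.Perm.SameCycle.refl] using congrFun h x
    · ext k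
      rcases eq_or_ne k j with rfl | hkj
      · simp [mulVec, hb]
      · have : ((1 - g.permMatrix ℚ) *ᵥ fun k => if (g.SameCycle x k ↔ b) then (0 : ℚ) else 1) k
            = 0 := by
          rw [sub_mulVec, one_mulVec, permMatrix_mulVec]
          simp
        refine Eq.trans ?_ this
        rw [mulVec, mulVec, updateRow_ne hkj]
  have h := congrFun (adjugate_permPencil_mulVec_eq hn g 1 fun _ => rfl) ⟨0, hn⟩
  have h2 := congrArg (evalRingHom 1) h
  simp only [mulVec, dotProduct, Pi.one_apply, mul_one, Pi.smul_apply, smul_eq_mul, map_sum] at h2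
  rw [← coe_evalRingHom, ← h2]
  refine sum_eq_zero fun j _ => ?_
  rw [← hadj ⟨0, hn⟩ j]
  have : (1 - g.permMatrix ℚ) = (evalRingHom 1).mapMatrix (permPencil g) := by
    ext i j
    simp only [permPencil_apply, Matrix.one_apply, PEquiv.toMatrix_apply, Equiv.toPEquiv_apply,
      RingHom.mapMatrix_apply, Matrix.map_apply, coe_evalRingHom, Matrix.sub_apply]
    split_ifs <;> simp_all
  rw [this, ← RingHom.map_adjugate]
  rfl

theorem IsTransitive.eq_univ_of_mapsTo {n : ℕ} {g : Equiv.Perm (Fin n)} (hg : IsTransitive g)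
    {S : Set (Fin n)} {x : Fin n} (hx : x ∈ S) (hS : ∀ y ∈ S, g y ∈ S) : S = Set.univ := by
  ext y
  obtain ⟨k, hk⟩ := (hg x y).exists_nat_pow_eq
  have : ∀ k : ℕ, (g ^ k) x ∈ S := by
    intro k
    induction k with
    | zero => exact hx
    | succ k ih => rw [pow_succ', Equiv.Perm.mul_apply]; exact hS _ ih
  simpa [← hk] using this k

theorem IsTransitive.apply_ne {n : ℕ} (hn : 2 ≤ n) {g : Equiv.Perm (Fin n)} (hg : IsTransitive g)
    (x : Fin n) : g x ≠ x := by
  intro h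
  have := hg.eq_univ_of_mapsTo (Set.mem_singleton x) (by simpa using h)
  have h2 := congrArg Set.ncard this
  rw [Set.ncard_singleton, Set.ncard_univ, Nat.card_fin] at h2
  omega

theorem IsTransitive.isCycle {n : ℕ} (hn : 2 ≤ n) {g : Equiv.Perm (Fin n)} (hg : IsTransitive g) :
    g.IsCycle :=
  ⟨⟨0, by omega⟩, hg.apply_ne hn _, fun _ _ => hg _ _⟩

theorem IsTransitive.support {n : ℕ} (hn : 2 ≤ n) {g : Equiv.Perm (Fin n)} (hg : IsTransitive g) :
    g.support = univ := by
  ext x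
  simpa using hg.apply_ne hn x

theorem isTransitive_iff_cycleType {n : ℕ} (hn : 2 ≤ n) {g : Equiv.Perm (Fin n)} :
    IsTransitive g ↔ g.cycleType = {n} := by
  constructor
  · intro hg
    rw [(hg.isCycle hn).cycleType, hg.support hn, card_univ, Fintype.card_fin]
  · intro h x y
    have hc : g.IsCycle := by
      rw [← Equiv.Perm.card_cycleType_eq_one, h, Multiset.card_singleton]
    have hs : g.support = univ := by
      rw [← card_eq_iff_eq_univ, ← Equiv.Perm.sum_cycleType, h, Multiset.sum_singleton,
        Fintype.card_fin]
    exact hc.sameCycle (Equiv.Perm.mem_support.mp (hs ▸ mem_univ x))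
      (Equiv.Perm.mem_support.mp (hs ▸ mem_univ y))

/-- A nonzero Leibniz term needs σ i = i or σ i = g i for every i. By injectivity the points moved
by σ are stable under g, so σ is 1 or g. -/
theorem det_permPencil_of_isTransitive {n : ℕ} (hn : 2 ≤ n) {g : Equiv.Perm (Fin n)}
    (hg : IsTransitive g) : (permPencil g).det = 1 - X ^ n := by
  have hg1 : (1 : Equiv.Perm (Fin n)) ≠ g := by
    rintro rfl
    exact hg.apply_ne hn ⟨0, by omega⟩ rfl
  rw [← det_transpose, det_apply, ← sum_subset (subset_univ {1, g}), sum_pair hg1]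
  · have hs : Equiv.Perm.sign g = (-1) ^ (n + 1) := by
      rw [Equiv.Perm.sign_of_cycleType, (isTransitive_iff_cycleType hn).mp hg]
      simp
    have h1 : ∀ i, (permPencil g)ᵀ ((1 : Equiv.Perm (Fin n)) i) i = 1 := by
      intro i
      simp [permPencil_apply, hg.apply_ne hn i]
    have h2 : ∀ i, (permPencil g)ᵀ (g i) i = -X := by
      intro i
      simp [permPencil_apply, (hg.apply_ne hn i).symm]
    rw [prod_congr rfl fun i _ => h1 i, prod_congr rfl fun i _ => h2 i, hs]
    simp only [prod_const, card_univ, Fintype.card_fin, Equiv.Perm.sign_one, one_pow, one_smul,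
      neg_pow (X : ℚ[X])]
    rw [Units.smul_def, zsmul_eq_mul]
    push_cast
    rw [← mul_assoc, ← pow_add, show n + 1 + n = 2 * n + 1 by ring, pow_succ, pow_mul]
    simp
    ring
  · intro σ _ hσ
    suffices hz : ∏ i, (permPencil g)ᵀ (σ i) i = 0 by rw [hz, smul_zero]
    by_contra hne
    have hi : ∀ i, σ i = i ∨ σ i = g i := by
      intro i
      have := prod_ne_zero_iff.mp hne i (mem_univ i)
      by_contra! h
      apply this
      simp [permPencil_apply, h.1.symm, h.2.symm]
    apply hσ
    rw [mem_insert, mem_singleton]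
    by_contra! h
    obtain ⟨x, hx⟩ : ∃ x, σ x ≠ x := by
      by_contra! h'
      exact h.1 (Equiv.ext h')
    have huniv := hg.eq_univ_of_mapsTo (S := {y | σ y ≠ y}) hx (by
      intro y hy hy'
      have h3 := (hi y).resolve_left hy
      rw [← h3] at hy'
      exact hy (σ.injective hy'))
    apply h.2
    ext1 y
    exact (hi y).resolve_left (huniv.symm.subset (Set.mem_univ y))

theorem reducedDet_eval_one_of_isTransitive {n : ℕ} (hn : 1 ≤ n) {g : Equiv.Perm (Fin n)}
    (hg : IsTransitive g) : (reducedDet g).eval 1 = n := by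
  obtain rfl | hn2 : n = 1 ∨ 2 ≤ n := by omega
  · rw [Subsingleton.elim g 1, reducedDet_one le_rfl]
    simp
  · have : reducedDet g = ∑ i ∈ range n, X ^ i := by
      apply mul_left_cancel₀ one_sub_X_ne_zero
      rw [one_sub_X_mul_reducedDet hn, det_permPencil_of_isTransitive hn2 hg,
        mul_neg_geom_sum]
    simp [this, eval_finsetSum]

open Classical in
theorem reducedDet_eval_one {n : ℕ} (hn : 1 ≤ n) (g : Equiv.Perm (Fin n)) :
    (reducedDet g).eval 1 = if IsTransitive g then (n : ℚ) else 0 := by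
  split_ifs with h
  · exact reducedDet_eval_one_of_isTransitive hn h
  · exact reducedDet_eval_one_of_not_isTransitive hn g h


/-! ### Iteration and the closed formula -/

theorem sum_seq_reducedDet {n : ℕ} (hn : 1 ≤ n) (p : ℕ) (g : Equiv.Perm (Fin n)) :
    ∑ τ : Fin p → swaps n, reducedDet ((List.ofFn fun i => (τ i : Equiv.Perm (Fin n))).prod * g) =
      (contentOp n ^ p) (reducedDet g) := by
  induction p with
  | zero => simp
  | succ p ih =>
    rw [← (Fin.consEquiv fun _ : Fin (p + 1) => swaps n).sum_comp, Fintype.sum_prod_type, sum_comm,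
      pow_succ', Module.End.mul_apply, ← ih, map_sum]
    refine sum_congr rfl fun τ _ => ?_
    rw [← sum_swaps_reducedDet hn, ← sum_coe_sort (swaps n)]
    refine sum_congr rfl fun a _ => ?_
    rw [List.ofFn_succ, List.prod_cons, mul_assoc]
    simp [Fin.consEquiv]

/-- The number of sequences of `p` transpositions with product `σ`. -/
noncomputable def productCount {n : ℕ} (p : ℕ) (σ : Equiv.Perm (Fin n)) : ℕ :=
  Nat.card {τ : Fin p → Equiv.Perm (Fin n) // (∀ i, (τ i).IsSwap) ∧ (List.ofFn τ).prod = σ}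

theorem productCount_eq_card {n : ℕ} (p : ℕ) (σ : Equiv.Perm (Fin n)) :
    productCount p σ =
      #{τ : Fin p → swaps n | (List.ofFn fun i => (τ i : Equiv.Perm (Fin n))).prod = σ} := by
  rw [productCount, ← Fintype.card_subtype, ← Nat.card_eq_fintype_card]
  refine Nat.card_congr ⟨fun τ => ⟨fun i => ⟨τ.1 i, mem_swaps.mpr (τ.2.1 i)⟩, τ.2.2⟩,
    fun τ => ⟨fun i => τ.1 i, fun i => mem_swaps.mp (τ.1 i).2, τ.2⟩, fun _ => rfl, fun _ => rfl⟩

theorem isSwap_conj {n : ℕ} (h : Equiv.Perm (Fin n)) {τ : Equiv.Perm (Fin n)} (hτ : τ.IsSwap) :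
    (MulAut.conj h τ).IsSwap := by
  rw [Equiv.Perm.isSwap_iff_cycleType] at hτ ⊢
  rw [MulAut.conj_apply, Equiv.Perm.cycleType_conj, hτ]

theorem productCount_conj {n : ℕ} (p : ℕ) (σ h : Equiv.Perm (Fin n)) :
    productCount p (MulAut.conj h σ) = productCount p σ := by
  symm
  refine Nat.card_congr (Equiv.subtypeEquiv
    (Equiv.piCongrRight fun _ => (MulAut.conj h).toEquiv) fun τ => and_congr ?_ ?_)
  · refine forall_congr' fun i => ⟨isSwap_conj h, fun hi => ?_⟩
    have := isSwap_conj h⁻¹ hi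
    simpa [mul_assoc] using this
  · rw [← (MulAut.conj h).injective.eq_iff, map_list_prod, List.map_ofFn]
    rfl

theorem isConj_longCycle {n : ℕ} {g : Equiv.Perm (Fin n)} (hg : IsTransitive g) :
    IsConj (longCycle n) g := by
  rcases Nat.lt_or_ge n 2 with h | h
  · have : Subsingleton (Fin n) := Fin.subsingleton_iff_le_one.mpr (by omega)
    rw [Subsingleton.elim g (longCycle n)]
  · rw [Equiv.Perm.isConj_iff_cycleType_eq, (isTransitive_iff_cycleType h).mp hg, longCycle,
      cycleType_finRotate_of_le h]

open Classical in
theorem card_isTransitive {n : ℕ} (hn : 1 ≤ n) :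
    #{g : Equiv.Perm (Fin n) | IsTransitive g} = (n - 1)! := by
  obtain rfl | h : n = 1 ∨ 2 ≤ n := by omega
  · rw [filter_true_of_mem]
    · rfl
    · intro g _ x y
      rw [Subsingleton.elim x y]
  · have := Equiv.Perm.card_of_cycleType_singleton (α := Fin n) h (by simp)
    rw [Fintype.card_fin, Nat.choose_self, mul_one] at this
    rw [← this]
    congr 1
    ext g
    simp [isTransitive_iff_cycleType h]

theorem factorial_mul_factorizationCount {n : ℕ} (hn : 1 ≤ n) (p : ℕ) :
    ((n - 1)! : ℚ) * n * factorizationCount n p =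
      ((contentOp n ^ p) ((1 - X) ^ (n - 1))).eval 1 := by
  classical
  rw [← reducedDet_one hn, ← sum_seq_reducedDet hn, eval_finsetSum]
  simp_rw [mul_one, reducedDet_eval_one hn]
  rw [← sum_filter, sum_const, nsmul_eq_mul, ← card_isTransitive hn]
  -- Group the sequences by their product; conjugation makes all fibres equinumerous.
  rw [card_eq_sum_card_fiberwise (t := {g : Equiv.Perm (Fin n) | IsTransitive g})
    (f := fun τ : Fin p → swaps n => (List.ofFn fun i => (τ i : Equiv.Perm (Fin n))).prod)]
  · rw [sum_congr rfl (g := fun _ => factorizationCount n p), sum_const]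
    · simp only [smul_eq_mul]
      push_cast
      ring
    · intro g hg
      obtain ⟨h, hh⟩ := isConj_iff.mp (isConj_longCycle (mem_filter.mp hg).2)
      rw [← MulAut.conj_apply] at hh
      change _ = productCount p (longCycle n)
      rw [← productCount_conj p (longCycle n) h, hh, productCount_eq_card, filter_filter]
      congr 1
      ext τ
      simp only [mem_filter, mem_univ, true_and, and_iff_right_iff_imp]
      rintro rfl
      exact (mem_filter.mp hg).2
  · intro τ hτ
    simpa using hτ

theorem factorizationCount_eq_sum {n : ℕ} (hn : 1 ≤ n) (p : ℕ) :
    (factorizationCount n p : ℚ) = (n : ℚ) ^ p / (n ! : ℚ) *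
      ∑ r ∈ Finset.range n,
        (-1 : ℚ) ^ r * ((n - 1).choose r : ℚ) * (((n : ℚ) - 1) / 2 - (r : ℚ)) ^ p := by
  have h := factorial_mul_factorizationCount hn p
  have hf : ((n - 1)! : ℚ) * n = (n ! : ℚ) := by
    rw [mul_comm]
    exact_mod_cast Nat.mul_factorial_pred (by omega)
  rw [hf, sub_eq_neg_add, add_pow, map_sum, eval_finsetSum, Nat.sub_add_cancel hn] at h
  rw [div_mul_eq_mul_div, eq_div_iff (by positivity), mul_comm, h, mul_sum]
  refine sum_congr rfl fun r _ => ?_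
  have : (-X : ℚ[X]) ^ r * 1 ^ (n - 1 - r) * ((n - 1).choose r : ℚ[X]) =
      ((-1) ^ r * ((n - 1).choose r : ℚ)) • X ^ r := by
    rw [smul_eq_C_mul, neg_pow]
    simp
    ring
  rw [this, map_smul, contentOp_pow_X_pow, mul_pow]
  simp
  ring


/-! ### Cycle counts, absolute length and parity -/

/-- A label of the cycle of `σ` through `x`. -/
def cycleLabel {n : ℕ} (σ : Equiv.Perm (Fin n)) (x : Fin n) : Equiv.Perm (Fin n) ⊕ Fin n :=
  if σ x = x then .inr x else .inl (σ.cycleOf x)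

theorem sameCycle_of_cycleLabel_eq {n : ℕ} {σ : Equiv.Perm (Fin n)} {x y : Fin n}
    (h : cycleLabel σ x = cycleLabel σ y) : σ.SameCycle x y := by
  unfold cycleLabel at h
  split_ifs at h with hx hy hy
  · rw [Sum.inr.inj h]
  · have h1 := Sum.inl.inj h
    by_contra hxy
    have h2 : σ.cycleOf y x = σ x := by rw [← h1, Equiv.Perm.cycleOf_apply_self]
    rw [Equiv.Perm.cycleOf_apply_of_not_sameCycle (fun h => hxy h.symm)] at h2
    exact hx h2.symm

theorem cycleLabel_apply {n : ℕ} (σ : Equiv.Perm (Fin n)) (x : Fin n) :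
    cycleLabel σ (σ x) = cycleLabel σ x := by
  unfold cycleLabel
  by_cases h : σ x = x
  · simp [h]
  · rw [if_neg h, if_neg (fun h' => h (σ.injective h')), Equiv.Perm.cycleOf_self_apply]

theorem card_image_cycleLabel {n : ℕ} (σ : Equiv.Perm (Fin n)) :
    #(univ.image (cycleLabel σ)) = cycleCount σ := by
  have h : univ.image (cycleLabel σ) = σ.cycleFactorsFinset.disjSum (univ \ σ.support) := by
    ext (c | x)
    · rw [inl_mem_disjSum, mem_image]
      constructor
      · rintro ⟨x, -, hx⟩
        unfold cycleLabel at hx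
        split_ifs at hx with h
        rw [← Sum.inl.inj hx, Equiv.Perm.cycleOf_mem_cycleFactorsFinset_iff]
        simpa using h
      · intro hc
        obtain ⟨x, hx⟩ := (Equiv.Perm.mem_cycleFactorsFinset_iff.mp hc).1.nonempty_support
        have hx2 := Equiv.Perm.mem_cycleFactorsFinset_support_le hc hx
        refine ⟨x, mem_univ _, ?_⟩
        rw [cycleLabel, if_neg (by simpa using hx2),
          Equiv.Perm.cycle_is_cycleOf hx hc]
    · rw [inr_mem_disjSum, mem_image]
      constructor
      · rintro ⟨y, -, hy⟩
        unfold cycleLabel at hy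
        split_ifs at hy with h
        rw [← Sum.inr.inj hy]
        simpa using h
      · intro hx
        refine ⟨x, mem_univ _, ?_⟩
        rw [cycleLabel, if_pos (by simpa using hx)]
  rw [h, card_disjSum, cycleCount, Equiv.Perm.parts_partition, Multiset.card_add,
    Multiset.card_replicate, Equiv.Perm.cycleType_def, Multiset.card_map,
    card_sdiff_of_subset (subset_univ _), card_univ]
  rfl

theorem card_image_le_cycleCount {n : ℕ} {β : Type*} [DecidableEq β] (σ : Equiv.Perm (Fin n))
    (m : Fin n → β) (hm : ∀ x, m (σ x) = m x) : #(univ.image m) ≤ cycleCount σ := by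
  have hcycle : ∀ x y, σ.SameCycle x y → m x = m y := by
    intro x y h
    obtain ⟨k, rfl⟩ := h.exists_nat_pow_eq
    induction k with
    | zero => rfl
    | succ k ih => rw [pow_succ', Equiv.Perm.mul_apply, hm]; exact ih ⟨k, by simp⟩
  rw [← card_image_cycleLabel]
  rcases isEmpty_or_nonempty (Fin n) with _ | _
  · simp [univ_eq_empty]
  choose! r hr using fun (c : Equiv.Perm (Fin n) ⊕ Fin n) (hc : c ∈ univ.image (cycleLabel σ)) =>
    mem_image.mp hc
  refine card_le_card_of_surjOn (fun c => m (r c)) ?_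
  intro b hb
  obtain ⟨x, -, rfl⟩ := mem_image.mp (mem_coe.mp hb)
  have hx : cycleLabel σ x ∈ univ.image (cycleLabel σ) := mem_image_of_mem _ (mem_univ x)
  exact ⟨cycleLabel σ x, hx, hcycle _ _ (sameCycle_of_cycleLabel_eq (hr _ hx).2)⟩

/-- Identifying the labels of the cycles through a and b gives a function invariant under both σ and
the transposition, and loses at most one value. -/
theorem cycleCount_le_swap_mul {n : ℕ} {σ τ : Equiv.Perm (Fin n)} (hτ : τ.IsSwap) :
    cycleCount σ ≤ cycleCount (τ * σ) + 1 := by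
  obtain ⟨a, b, hab, rfl⟩ := hτ
  set m : Fin n → Equiv.Perm (Fin n) ⊕ Fin n :=
    fun x => if cycleLabel σ x = cycleLabel σ b then cycleLabel σ a else cycleLabel σ x with hm
  have hinv : ∀ x, m ((Equiv.swap a b * σ) x) = m x := by
    intro x
    have hx := cycleLabel_apply σ x
    have h1 : m (σ x) = m x := by simp only [hm, hx]
    have h2 : ∀ y, m (Equiv.swap a b y) = m y := by
      intro y
      rw [Equiv.swap_apply_def]
      split_ifs with h3 h4
      · rw [h3, hm]; simp
      · rw [h4, hm]; simp
      · rfl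
    rw [Equiv.Perm.mul_apply, h2, h1]
  have h := card_image_le_cycleCount _ m hinv
  rw [← card_image_cycleLabel]
  refine le_trans ?_ (Nat.add_le_add_right h 1)
  refine le_trans (card_le_card (t := insert (cycleLabel σ b) (univ.image m)) ?_)
    (card_insert_le _ _)
  intro c hc
  obtain ⟨x, -, rfl⟩ := mem_image.mp hc
  by_cases hx : cycleLabel σ x = cycleLabel σ b
  · rw [hx]
    exact mem_insert_self _ _
  · refine mem_insert_of_mem (mem_image.mpr ⟨x, mem_univ _, ?_⟩)
    simp [hm, hx]

theorem cycleCount_le {n : ℕ} (σ : Equiv.Perm (Fin n)) : cycleCount σ ≤ n := by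
  rw [← card_image_cycleLabel]
  exact card_image_le.trans (by simp)

theorem sign_eq_absLength {n : ℕ} (σ : Equiv.Perm (Fin n)) :
    Equiv.Perm.sign σ = (-1) ^ absLength σ := by
  have h : Multiset.card σ.cycleType + (n - σ.cycleType.sum) = cycleCount σ := by
    rw [cycleCount, Equiv.Perm.parts_partition, Multiset.card_add, Multiset.card_replicate,
      Equiv.Perm.sum_cycleType, Fintype.card_fin]
  have h1 := cycleCount_le σ
  have h2 : σ.cycleType.sum ≤ n := by simpa using σ.sum_cycleType_le
  rw [Equiv.Perm.sign_of_cycleType, absLength]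
  have h3 : σ.cycleType.sum + Multiset.card σ.cycleType =
      (n - cycleCount σ) + 2 * Multiset.card σ.cycleType := by omega
  rw [h3, pow_add, pow_mul]
  simp

/-- The cycle count moves by at most one in either direction, and the sign forbids no change. -/
theorem absLength_swap_mul {n : ℕ} {σ τ : Equiv.Perm (Fin n)} (hτ : τ.IsSwap) :
    absLength (τ * σ) = absLength σ + 1 ∨ absLength σ = absLength (τ * σ) + 1 := by
  have h1 := cycleCount_le_swap_mul (σ := σ) hτ
  have h2 := cycleCount_le_swap_mul (σ := τ * σ) hτ
  have hττ : τ * τ = 1 := by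
    obtain ⟨a, b, -, rfl⟩ := hτ
    exact Equiv.swap_mul_self a b
  rw [← mul_assoc, hττ, one_mul] at h2
  have h3 := cycleCount_le σ
  have h4 := cycleCount_le (τ * σ)
  have h5 : absLength (τ * σ) ≠ absLength σ := by
    intro h
    have hs := sign_eq_absLength (τ * σ)
    rw [Equiv.Perm.sign_mul, hτ.sign_eq, sign_eq_absLength σ, h] at hs
    rcases Int.units_eq_one_or ((-1) ^ absLength σ) with h' | h' <;> rw [h'] at hs <;>
      exact absurd hs (by decide)
  unfold absLength at h5 ⊢
  omega

theorem absLength_eq_zero_iff {n : ℕ} {σ : Equiv.Perm (Fin n)} : absLength σ = 0 ↔ σ = 1 := by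
  constructor
  · intro h
    have h1 : n ≤ cycleCount σ := by unfold absLength at h; omega
    rw [← card_image_cycleLabel] at h1
    have h2 : Function.Injective (cycleLabel σ) := by
      rw [← Set.injOn_univ, ← coe_univ, ← card_image_iff]
      exact le_antisymm card_image_le (by simpa using h1)
    ext1 x
    exact h2 (cycleLabel_apply σ x)
  · rintro rfl
    have : #(univ.image (id : Fin n → Fin n)) ≤ cycleCount (1 : Equiv.Perm (Fin n)) :=
      card_image_le_cycleCount _ _ fun _ => rfl
    rw [image_id, card_univ, Fintype.card_fin] at this
    unfold absLength
    omega

theorem absLength_longCycle {n : ℕ} (hn : 1 ≤ n) : absLength (longCycle n) = n - 1 := by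
  obtain rfl | h : n = 1 ∨ 2 ≤ n := by omega
  · exact absLength_eq_zero_iff.mpr (Subsingleton.elim _ _)
  · rw [absLength, cycleCount, Equiv.Perm.parts_partition, Multiset.card_add,
      Multiset.card_replicate, ← Equiv.Perm.sum_cycleType, longCycle, cycleType_finRotate_of_le h]
    simp

theorem absLength_prod_le {n : ℕ} (l : List (Equiv.Perm (Fin n))) (hl : ∀ τ ∈ l, τ.IsSwap) :
    absLength l.prod ≤ l.length := by
  induction l with
  | nil => simp [absLength_eq_zero_iff.mpr]
  | cons τ l ih =>
    have h := absLength_swap_mul (σ := l.prod) (hl τ List.mem_cons_self)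
    have := ih fun t ht => hl t (List.mem_cons_of_mem _ ht)
    rw [List.prod_cons, List.length_cons]
    omega

theorem exists_of_factorizationCount_ne_zero {n : ℕ} (hn : 1 ≤ n) {p : ℕ}
    (h : factorizationCount n p ≠ 0) : ∃ d, p = n - 1 + 2 * d := by
  obtain ⟨τ, hτ, hprod⟩ := (Nat.card_ne_zero.mp h).1
  have h1 := absLength_prod_le (List.ofFn τ) (by simpa [List.mem_ofFn] using hτ)
  rw [hprod, absLength_longCycle hn, List.length_ofFn] at h1
  have h2 := congrArg Equiv.Perm.sign hprod
  rw [map_list_prod, List.map_ofFn, longCycle, sign_finRotate] at h2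
  have h3 : (Equiv.Perm.sign ∘ τ) = fun _ => -1 := by
    ext i
    simp [(hτ i).sign_eq]
  rw [h3, List.ofFn_const, List.prod_replicate] at h2
  obtain ⟨k, rfl⟩ := Nat.exists_eq_add_of_le h1
  rw [pow_add] at h2
  have h4 : (-1 : ℤˣ) ^ k = 1 := by
    apply mul_left_cancel (a := (-1 : ℤˣ) ^ (n - 1))
    rw [h2, mul_one]
  rcases Nat.even_or_odd k with hk | hk
  · obtain ⟨d, rfl⟩ := hk
    exact ⟨d, by ring⟩
  · rw [hk.neg_one_pow] at h4
    exact absurd h4 (by decide)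

/-- Prepend one transposition twice. -/
theorem factorizationCount_add_two_ne_zero {n : ℕ} (hn : 2 ≤ n) {p : ℕ}
    (h : factorizationCount n p ≠ 0) : factorizationCount n (p + 2) ≠ 0 := by
  obtain ⟨τ, hτ, hprod⟩ := (Nat.card_ne_zero.mp h).1
  set t : Equiv.Perm (Fin n) := Equiv.swap ⟨0, by omega⟩ ⟨1, by omega⟩ with ht
  have hswap : t.IsSwap := ⟨_, _, by simp, ht⟩
  refine Nat.card_ne_zero.mpr ⟨⟨Fin.cons t (Fin.cons t τ), ?_, ?_⟩, inferInstance⟩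
  · intro i
    refine Fin.cases hswap (fun j => ?_) i
    refine Fin.cases hswap (fun k => ?_) j
    simpa using hτ k
  · rw [List.ofFn_cons, List.ofFn_cons, List.prod_cons, List.prod_cons, hprod, ← mul_assoc, ht,
      Equiv.swap_mul_self, one_mul]

/-! ### Paths and factorizations -/

theorem absLength_add_length {n k : ℕ} (γ : Fin (k + 1) → Equiv.Perm (Fin n)) (hγ : IsPath γ) :
    absLength (γ (Fin.last k)) + k = absLength (γ 0) + 2 * defect γ := by
  have hstep : ∀ i : Fin k, (absLength (γ i.succ) : ℤ) - absLength (γ i.castSucc) =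
      2 * (if absLength (γ i.succ) = absLength (γ i.castSucc) + 1 then 1 else 0) - 1 := by
    intro i
    have h := absLength_swap_mul (σ := γ i.succ) (hγ i)
    rw [inv_mul_cancel_right] at h
    split_ifs <;> omega
  have htel : ∀ f : Fin (k + 1) → ℤ,
      ∑ i : Fin k, (f i.succ - f i.castSucc) = f (Fin.last k) - f 0 := by
    intro f
    rw [sum_sub_distrib]
    linarith [Fin.sum_univ_succ f, Fin.sum_univ_castSucc f]
  have h := htel fun i => (absLength (γ i) : ℤ)
  simp_rw [hstep] at h
  rw [sum_sub_distrib, ← mul_sum, sum_boole] at h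
  simp only [sum_const, card_univ, Fintype.card_fin, nsmul_eq_mul, mul_one] at h
  unfold defect
  omega

theorem partialProd_last {G : Type*} [Group G] {p : ℕ} (τ : Fin p → G) :
    Fin.partialProd τ (Fin.last p) = (List.ofFn τ).prod := by
  rw [Fin.partialProd, Fin.val_last, List.take_of_length_le (by simp)]

/-- The path of τ is γ_i = (τ_1 ⋯ τ_i)⁻¹ (1 … n). At this length, defect d means ending at the
identity, that is, the full product is the cycle. -/
theorem factorizationCount_eq_pathCount {n : ℕ} (hn : 1 ≤ n) (d : ℕ) :
    factorizationCount n (n - 1 + 2 * d) = pathCount (longCycle n) (n - 1 + 2 * d) d := by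
  have hdef : ∀ γ : Fin (n - 1 + 2 * d + 1) → Equiv.Perm (Fin n), γ 0 = longCycle n → IsPath γ →
      (defect γ = d ↔ γ (Fin.last _) = 1) := by
    intro γ h0 hγ
    have h := absLength_add_length γ hγ
    rw [h0, absLength_longCycle hn] at h
    rw [← absLength_eq_zero_iff]
    omega
  have hback : ∀ γ : Fin (n - 1 + 2 * d + 1) → Equiv.Perm (Fin n), ∀ i,
      Fin.partialProd (fun j : Fin (n - 1 + 2 * d) => γ j.castSucc * (γ j.succ)⁻¹) i =
        γ 0 * (γ i)⁻¹ := by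
    intro γ i
    refine Fin.induction ?_ (fun j ih => ?_) i
    · simp
    · rw [Fin.partialProd_succ, ih]
      group
  refine Nat.card_congr ⟨fun τ => ⟨fun i => (Fin.partialProd τ.1 i)⁻¹ * longCycle n, ?_, ?_⟩,
    fun γ => ⟨fun j => γ.1 j.castSucc * (γ.1 j.succ)⁻¹, fun i => γ.2.2.1 i, ?_⟩, ?_, ?_⟩
  · simp
  · have hpath : IsPath fun i => (Fin.partialProd τ.1 i)⁻¹ * longCycle n := by
      intro i
      change ((Fin.partialProd τ.1 i.castSucc)⁻¹ * longCycle n *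
        ((Fin.partialProd τ.1 i.succ)⁻¹ * longCycle n)⁻¹).IsSwap
      rw [Fin.partialProd_succ]
      convert τ.2.1 i using 1
      group
    refine ⟨hpath, (hdef _ (by simp) hpath).mpr ?_⟩
    rw [partialProd_last, τ.2.2, inv_mul_cancel]
  · rw [← partialProd_last, hback, (hdef _ γ.2.1 γ.2.2.1).mp γ.2.2.2, γ.2.1, inv_one, mul_one]
  · intro τ
    ext1
    funext i
    simp only [Fin.partialProd_succ]
    group
  · intro γ
    ext1
    funext i
    simp only [hback]
    rw [γ.2.1]
    group


/-! ### Exponential generating functions -/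

theorem hasSum_factorizationCount {n : ℕ} (hn : 1 ≤ n) (x : ℂ) :
    HasSum (fun p : ℕ => (factorizationCount n p : ℂ) * (x ^ p / (p ! : ℂ)))
      (1 / (n ! : ℂ) * Complex.exp ((n : ℂ) * ((n : ℂ) - 1) / 2 * x) *
        (1 - Complex.exp (-(n : ℂ) * x)) ^ (n - 1)) := by
  have h1 : ∀ p, (factorizationCount n p : ℂ) * (x ^ p / (p ! : ℂ)) =
      ∑ r ∈ range n, (1 / (n ! : ℂ) * ((-1) ^ r * ((n - 1).choose r : ℂ))) *
        ((n * (((n : ℂ) - 1) / 2 - r) * x) ^ p / (p ! : ℂ)) := by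
    intro p
    have h := congrArg (Rat.cast : ℚ → ℂ) (factorizationCount_eq_sum hn p)
    push_cast at h
    rw [h, mul_sum, sum_mul]
    refine sum_congr rfl fun r _ => ?_
    rw [mul_pow, mul_pow]
    ring
  have h2 : 1 / (n ! : ℂ) * Complex.exp ((n : ℂ) * ((n : ℂ) - 1) / 2 * x) *
        (1 - Complex.exp (-(n : ℂ) * x)) ^ (n - 1) =
      ∑ r ∈ range n, (1 / (n ! : ℂ) * ((-1) ^ r * ((n - 1).choose r : ℂ))) *
        Complex.exp (n * (((n : ℂ) - 1) / 2 - r) * x) := by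
    rw [sub_eq_neg_add 1, add_pow, Nat.sub_add_cancel hn, mul_sum]
    refine sum_congr rfl fun r _ => ?_
    have : Complex.exp (n * (((n : ℂ) - 1) / 2 - r) * x) =
        Complex.exp ((n : ℂ) * ((n : ℂ) - 1) / 2 * x) * Complex.exp (-(n : ℂ) * x) ^ r := by
      rw [← Complex.exp_nat_mul, ← Complex.exp_add]
      congr 1
      ring
    rw [this, neg_pow]
    ring
  simp_rw [h1]
  rw [h2]
  refine hasSum_sum fun r _ => HasSum.mul_left _ ?_
  rw [Complex.exp_eq_exp_ℂ]
  exact NormedSpace.expSeries_div_hasSum_exp _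

theorem powerSeries_factorizationCount {n : ℕ} (hn : 1 ≤ n) :
    PowerSeries.mk (fun p : ℕ => (factorizationCount n p : ℚ) / (p ! : ℚ)) =
      PowerSeries.C (1 / (n ! : ℚ)) *
        PowerSeries.rescale ((n : ℚ) * ((n : ℚ) - 1) / 2) (PowerSeries.exp ℚ) *
        (1 - PowerSeries.rescale (-(n : ℚ)) (PowerSeries.exp ℚ)) ^ (n - 1) := by
  have h2 : PowerSeries.rescale ((n : ℚ) * ((n : ℚ) - 1) / 2) (PowerSeries.exp ℚ) *
        (1 - PowerSeries.rescale (-(n : ℚ)) (PowerSeries.exp ℚ)) ^ (n - 1) =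
      ∑ r ∈ range n, PowerSeries.C ((-1) ^ r * ((n - 1).choose r : ℚ)) *
        PowerSeries.rescale (n * (((n : ℚ) - 1) / 2 - r)) (PowerSeries.exp ℚ) := by
    rw [sub_eq_neg_add 1, add_pow, Nat.sub_add_cancel hn, mul_sum]
    refine sum_congr rfl fun r _ => ?_
    have : PowerSeries.rescale (n * (((n : ℚ) - 1) / 2 - r)) (PowerSeries.exp ℚ) =
        PowerSeries.rescale ((n : ℚ) * ((n : ℚ) - 1) / 2) (PowerSeries.exp ℚ) *
          PowerSeries.rescale (-(n : ℚ)) (PowerSeries.exp ℚ) ^ r := by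
      rw [← map_pow, PowerSeries.exp_pow_eq_rescale_exp, PowerSeries.rescale_rescale,
        PowerSeries.exp_mul_exp_eq_exp_add]
      congr 2
      ring
    rw [this, neg_pow]
    simp
    ring
  rw [mul_assoc, h2]
  ext p
  rw [PowerSeries.coeff_mk, PowerSeries.coeff_C_mul, map_sum, factorizationCount_eq_sum hn]
  simp_rw [PowerSeries.coeff_C_mul, PowerSeries.coeff_rescale, PowerSeries.coeff_exp, mul_pow]
  simp only [eq_ratCast, Rat.cast_id, mul_sum, sum_div]
  refine sum_congr rfl fun r _ => ?_
  ring

/-! ### Expansion of sinh and the first values -/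

/-- The power series `sinh (c x) / (c x)` with `c = n / 2`. -/
noncomputable def sinhc (n : ℕ) : PowerSeries ℚ :=
  PowerSeries.mk fun k => (((n : ℚ) / 2) ^ (k + 1) - (-(n : ℚ) / 2) ^ (k + 1)) / (n * (k + 1)!)

theorem rescale_exp_sub_rescale_exp {n : ℕ} (hn : 1 ≤ n) :
    PowerSeries.rescale ((n : ℚ) / 2) (PowerSeries.exp ℚ) -
      PowerSeries.rescale (-(n : ℚ) / 2) (PowerSeries.exp ℚ) =
      PowerSeries.C (n : ℚ) * (PowerSeries.X * sinhc n) := by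
  have : (n : ℚ) ≠ 0 := by positivity
  ext k
  rw [map_sub, PowerSeries.coeff_C_mul, PowerSeries.coeff_rescale, PowerSeries.coeff_rescale,
    PowerSeries.coeff_exp]
  rcases k with _ | k
  · simp
  · rw [PowerSeries.coeff_succ_X_mul, sinhc, PowerSeries.coeff_mk]
    simp only [eq_ratCast, Rat.cast_id]
    field_simp

/-- Giving one factor e^(nx/2) to each 1 - e^(-nx) turns it into 2 sinh(nx/2). The extracted power
of X makes c_{n,n-1+j} a coefficient of low degree j. -/
theorem powerSeries_factorizationCount_eq_sinhc {n : ℕ} (hn : 1 ≤ n) :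
    PowerSeries.mk (fun p : ℕ => (factorizationCount n p : ℚ) / (p ! : ℚ)) =
      PowerSeries.C ((n : ℚ) ^ (n - 1) / (n ! : ℚ)) *
        (PowerSeries.X ^ (n - 1) * sinhc n ^ (n - 1)) := by
  have h1 : PowerSeries.rescale ((n : ℚ) * ((n : ℚ) - 1) / 2) (PowerSeries.exp ℚ) =
      PowerSeries.rescale ((n : ℚ) / 2) (PowerSeries.exp ℚ) ^ (n - 1) := by
    rw [← map_pow, PowerSeries.exp_pow_eq_rescale_exp, PowerSeries.rescale_rescale,
      Nat.cast_sub hn]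
    congr 2
    push_cast
    ring
  have h2 : PowerSeries.rescale ((n : ℚ) / 2) (PowerSeries.exp ℚ) *
      (1 - PowerSeries.rescale (-(n : ℚ)) (PowerSeries.exp ℚ)) =
      PowerSeries.C (n : ℚ) * (PowerSeries.X * sinhc n) := by
    rw [mul_sub, mul_one, PowerSeries.exp_mul_exp_eq_exp_add, ← rescale_exp_sub_rescale_exp hn]
    congr 3
    ring
  rw [powerSeries_factorizationCount hn, h1, mul_assoc, ← mul_pow, h2, mul_pow, mul_pow,
    ← map_pow, ← mul_assoc, ← map_mul]
  congr 2
  ring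

theorem factorizationCount_add {n : ℕ} (hn : 1 ≤ n) (j : ℕ) :
    (factorizationCount n (n - 1 + j) : ℚ) = (n - 1 + j)! * ((n : ℚ) ^ (n - 1) / (n ! : ℚ)) *
      PowerSeries.coeff j (sinhc n ^ (n - 1)) := by
  have h := congrArg (PowerSeries.coeff (n - 1 + j)) (powerSeries_factorizationCount_eq_sinhc hn)
  rw [PowerSeries.coeff_mk, PowerSeries.coeff_C_mul, add_comm (n - 1) j,
    PowerSeries.coeff_X_pow_mul] at h
  rw [add_comm (n - 1) j, mul_assoc, ← h]
  field_simp

/-- The first coefficients of a power of `1 + a X² + b X⁴ + ⋯`. -/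
theorem coeff_pow_of_even {F : PowerSeries ℚ} {a b : ℚ} (h0 : PowerSeries.coeff 0 F = 1)
    (h1 : PowerSeries.coeff 1 F = 0) (h2 : PowerSeries.coeff 2 F = a)
    (h3 : PowerSeries.coeff 3 F = 0) (h4 : PowerSeries.coeff 4 F = b) (m : ℕ) :
    PowerSeries.coeff 0 (F ^ m) = 1 ∧ PowerSeries.coeff 1 (F ^ m) = 0 ∧
      PowerSeries.coeff 2 (F ^ m) = m * a ∧ PowerSeries.coeff 3 (F ^ m) = 0 ∧
      PowerSeries.coeff 4 (F ^ m) = m * b + m * (m - 1) / 2 * a ^ 2 := by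
  induction m with
  | zero => simp [PowerSeries.coeff_one]
  | succ m ih =>
    obtain ⟨i0, i1, i2, i3, i4⟩ := ih
    simp only [pow_succ, PowerSeries.coeff_mul, Nat.antidiagonal_succ, Nat.antidiagonal_zero,
      map_singleton, sum_cons, map_cons, sum_singleton, Function.Embedding.prodMap,
      Function.Embedding.coeFn_mk, Prod.map, Function.Embedding.refl_apply, Nat.succ_eq_add_one,
      zero_add, Nat.reduceAdd, h0, h1, h2, h3, h4, i0, i1, i2, i3, i4]
    push_cast
    refine ⟨?_, ?_, ?_, ?_, ?_⟩ <;> ring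

theorem coeff_sinhc_pow {n : ℕ} (hn : 1 ≤ n) (m : ℕ) :
    PowerSeries.coeff 0 (sinhc n ^ m) = 1 ∧ PowerSeries.coeff 2 (sinhc n ^ m) = m * (n ^ 2 / 24) ∧
      PowerSeries.coeff 4 (sinhc n ^ m) =
        m * (n ^ 4 / 1920) + m * (m - 1) / 2 * ((n : ℚ) ^ 2 / 24) ^ 2 := by
  have hn0 : (n : ℚ) ≠ 0 := by positivity
  -- From sinh(y)/y = 1 + y²/6 + y⁴/120 + ⋯ at y = nx/2.
  have h := coeff_pow_of_even (F := sinhc n) (a := (n : ℚ) ^ 2 / 24) (b := (n : ℚ) ^ 4 / 1920)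
    (by rw [sinhc, PowerSeries.coeff_mk]; simp [Nat.factorial]; field_simp; norm_num)
    (by rw [sinhc, PowerSeries.coeff_mk]; simp [Nat.factorial]; left; ring)
    (by rw [sinhc, PowerSeries.coeff_mk]; simp [Nat.factorial]; field_simp; norm_num)
    (by rw [sinhc, PowerSeries.coeff_mk]; simp [Nat.factorial]; left; ring)
    (by rw [sinhc, PowerSeries.coeff_mk]; simp [Nat.factorial]; field_simp; norm_num) m
  exact ⟨h.1, h.2.2.1, h.2.2.2.2⟩

theorem factorizationCount_sub_one {n : ℕ} (hn : 1 ≤ n) :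
    (factorizationCount n (n - 1) : ℚ) = (n : ℚ) ^ ((n : ℤ) - 2) := by
  obtain ⟨m, rfl⟩ := Nat.exists_eq_add_of_le' hn
  have h := factorizationCount_add hn 0
  rw [(coeff_sinhc_pow hn _).1] at h
  simp only [Nat.add_sub_cancel, add_zero, Nat.factorial_succ] at h ⊢
  rw [h, show ((m + 1 : ℕ) : ℤ) - 2 = (m : ℤ) - 1 by push_cast; ring,
    zpow_sub_one₀ (by positivity), zpow_natCast]
  push_cast
  field_simp

theorem factorizationCount_add_one {n : ℕ} (hn : 1 ≤ n) :
    (factorizationCount n (n + 1) : ℚ) = 1 / 24 * ((n : ℚ) ^ 2 - 1) * (n : ℚ) ^ (n + 1) := by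
  obtain ⟨m, rfl⟩ := Nat.exists_eq_add_of_le' hn
  have h := factorizationCount_add hn 2
  rw [(coeff_sinhc_pow hn _).2.1] at h
  simp only [Nat.add_sub_cancel, Nat.factorial_succ] at h ⊢
  rw [show m + 1 + 1 = m + 2 by ring, h]
  push_cast
  field_simp
  ring

theorem factorizationCount_add_three {n : ℕ} (hn : 1 ≤ n) :
    (factorizationCount n (n + 3) : ℚ) =
      1 / 5760 * (5 * (n : ℚ) - 7) * ((n : ℚ) + 3) * ((n : ℚ) + 2) * ((n : ℚ) ^ 2 - 1) *
        (n : ℚ) ^ (n + 3) := by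
  obtain ⟨m, rfl⟩ := Nat.exists_eq_add_of_le' hn
  have h := factorizationCount_add hn 4
  rw [(coeff_sinhc_pow hn _).2.2] at h
  simp only [Nat.add_sub_cancel, Nat.factorial_succ] at h ⊢
  rw [show m + 1 + 3 = m + 4 by ring, h]
  push_cast
  field_simp
  ring

theorem factorizationCount_ne_zero {n : ℕ} (hn : 2 ≤ n) (d : ℕ) :
    factorizationCount n (n - 1 + 2 * d) ≠ 0 := by
  induction d with
  | zero =>
    have h := factorizationCount_sub_one (n := n) (by omega)
    intro h0
    rw [mul_zero, add_zero] at h0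
    rw [h0, Nat.cast_zero] at h
    exact zpow_ne_zero _ (by positivity) h.symm
  | succ d ih => exact factorizationCount_add_two_ne_zero hn ih

theorem factorizationCount_one_ne_zero_iff (p : ℕ) : factorizationCount 1 p ≠ 0 ↔ p = 0 := by
  constructor
  · intro h
    obtain ⟨τ, hτ, -⟩ := (Nat.card_ne_zero.mp h).1
    by_contra hp
    obtain ⟨a, b, hab, -⟩ := hτ ⟨0, Nat.pos_of_ne_zero hp⟩
    exact hab (Subsingleton.elim a b)
  · rintro rfl
    exact Nat.card_ne_zero.mpr
      ⟨⟨Fin.elim0, fun i => i.elim0, Subsingleton.elim _ _⟩, inferInstance⟩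

end TranspositionFactorizations

open TranspositionFactorizations in
theorem mainTheorem7 (n : ℕ) (hn : 1 ≤ n) :
    (2 ≤ n → ∀ p : ℕ, factorizationCount n p ≠ 0 ↔ ∃ d : ℕ, p = n - 1 + 2 * d) ∧
    (n = 1 → ∀ p : ℕ, factorizationCount n p ≠ 0 ↔ p = 0) ∧
    (∀ p d : ℕ, p = n - 1 + 2 * d →
      factorizationCount n p = pathCount (longCycle n) (n - 1 + 2 * d) d ∧
      (factorizationCount n p : ℚ) = (n : ℚ) ^ p / (n ! : ℚ) *
        ∑ r ∈ Finset.range n,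
          (-1 : ℚ) ^ r * ((n - 1).choose r : ℚ) * (((n : ℚ) - 1) / 2 - (r : ℚ)) ^ p) ∧
    (∀ x : ℂ, HasSum (fun p : ℕ => (factorizationCount n p : ℂ) * (x ^ p / (p ! : ℂ)))
      (1 / (n ! : ℂ) * Complex.exp ((n : ℂ) * ((n : ℂ) - 1) / 2 * x) *
        (1 - Complex.exp (-(n : ℂ) * x)) ^ (n - 1))) ∧
    (PowerSeries.mk (fun p : ℕ => (factorizationCount n p : ℚ) / (p ! : ℚ)) =
      PowerSeries.C (1 / (n ! : ℚ)) *
        PowerSeries.rescale ((n : ℚ) * ((n : ℚ) - 1) / 2) (PowerSeries.exp ℚ) *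
        (1 - PowerSeries.rescale (-(n : ℚ)) (PowerSeries.exp ℚ)) ^ (n - 1)) ∧
    (factorizationCount n (n - 1) : ℚ) = (n : ℚ) ^ ((n : ℤ) - 2) ∧
    (factorizationCount n (n + 1) : ℚ) = 1 / 24 * ((n : ℚ) ^ 2 - 1) * (n : ℚ) ^ (n + 1) ∧
    (factorizationCount n (n + 3) : ℚ) =
      1 / 5760 * (5 * (n : ℚ) - 7) * ((n : ℚ) + 3) * ((n : ℚ) + 2) * ((n : ℚ) ^ 2 - 1) *
        (n : ℚ) ^ (n + 3) := by
  refine ⟨fun h p => ⟨exists_of_factorizationCount_ne_zero hn, ?_⟩, ?_, ?_,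
    hasSum_factorizationCount hn, powerSeries_factorizationCount hn, factorizationCount_sub_one hn,
    factorizationCount_add_one hn, factorizationCount_add_three hn⟩
  · rintro ⟨d, rfl⟩
    exact factorizationCount_ne_zero h d
  · rintro rfl
    exact factorizationCount_one_ne_zero_iff
  · rintro p d rfl
    exact ⟨factorizationCount_eq_pathCount hn d, factorizationCount_eq_sum hn _⟩
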